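/- For a finite set $\Lambda$ with $N:=|\Lambda|\ge 2$, let $U:\mathbb{R}^\Lambda\to\mathbb{R}\times\mathbb{R}^{N-1}$ be an orthogonal linear map with $(U\phi)_1=N^{-1/2}\sum_{x\in\Lambda}\phi(x)$ for all $\phi\in\mathbb{R}^\Lambda$. For $\rho>0$, $|m|<\sqrt\rho$ and bounded continuous $F:\mathbb{R}^\Lambda\to\mathbb{R}$, define the auxiliary microcanonical expectation and partition function $$\langle F\rangle_{\mathrm{MC}}^{m,\rho;N}:=\frac{1}{|\mathbb{S}^{N-2}|}\int_{\mathbb{S}^{N-2}}d\Omega\,(F\circ U^{-1})\bigl(m\sqrt N,\sqrt{N(\rho-m^2)}\,\Omega\bigr),\qquad Z_{\mathrm{MC}}(m,\rho;N):=(\rho-m^2)^{\frac{N-3}{2}},$$ and, for $\mu\in\mathbb{R}$, the auxiliary canonical expectation $$\langle F\rangle_{\mathrm{C}}^{\mu,\rho;N}:=\frac{\int_{-\sqrt\rho}^{\sqrt\rho}dm'\,e^{-\mu Nm'}Z_{\mathrm{MC}}(m',\rho;N)\,\langle F\rangle_{\mathrm{MC}}^{m',\rho;N}}{\int_{-\sqrt\rho}^{\sqrt\rho}dm'\,e^{-\mu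 Nm'}Z_{\mathrm{MC}}(m',\rho;N)}.$$ For $I\subset\Lambda$ with $|I|=n$ and a bijection $\pi:I\to\{1,\dots,n\}$, let $P_I:\mathbb{R}^\Lambda\to\mathbb{R}^n$, $(P_I\phi)_j:=\phi(\pi^{-1}(j))$. **Theorem.** Let $\rho>0$ and $m\in(-\sqrt\rho,\sqrt\rho)$, and define $\mu:=-\frac{m}{\rho-m^2}$. Let $n\ge 0$ be a fixed integer and let $f:\mathbb{R}^n\to\mathbb{R}$ be bounded and $1$-Lipschitz with respect to the Euclidean norm $\|\cdot\|_2$. Then $$\langle f\circ P_I\rangle_{\mathrm{MC}}^{m,\rho;N}=\langle f\circ P_I\rangle_{\mathrm{C}}^{\mu,\rho;N}+O(N^{-1/2})\qquad(N\to\infty),$$ that is, there are $C\in\mathbb{R}$ and $N_0\in\mathbb{N}$, depending only on $\rho$, $m$, $n$ and $f$, such that $$\bigl|\langle f\circ P_I\rangle_{\mathrm{MC}}^{m,\rho;N}-\langle f\circ P_I\rangle_{\mathrm{C}}^{\mu,\rho;N}\bigr|\le C\,N^{-1/2}$$ for every finite set $\Lambda$ with $N=|\Lambda|\ge N_0$,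 every $U$ as above, every $I\subset\Lambda$ with $|I|=n$ and every bijection $\pi:I\to\{1,\dots,n\}$. -/

import Mathlib

open MeasureTheory

namespace MeanFieldSpherical

noncomputable section

/-- The space `ℝ × ℝ^(N - 1)` with its Euclidean norm, written in the coordinates `(z, ψ)`. -/
abbrev SplitSpace (N : ℕ) : Type :=
  WithLp 2 (ℝ × EuclideanSpace ℝ (Fin (N - 1)))

/-- An orthogonal map `U : ℝ^Λ → ℝ × ℝ^(N - 1)`, `N = |Λ|`, whose first coordinate is
`N^(-1/2) ∑ x, φ x`. Its remaining coordinates then vanish on constant fields, so that `U`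
diagonalizes the matrix whose entries are all equal to `1`. -/
def IsMagnetizationFrame {Λ : Type*} [Fintype Λ]
    (U : EuclideanSpace ℝ Λ ≃ₗᵢ[ℝ] SplitSpace (Fintype.card Λ)) : Prop :=
  ∀ φ : EuclideanSpace ℝ Λ,
    (U φ).fst = 1 / Real.sqrt (Fintype.card Λ : ℝ) * ∑ x, φ x

/-- Expectation `⟨F⟩_MC^{m, ρ; N}` in the auxiliary microcanonical ensemble: the normalized
surface average of `F (U⁻¹ (m √N, √(N (ρ - m²)) Ω))` over `Ω` in the unit sphere of `ℝ^(N - 1)`. -/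
def microcanonical {Λ : Type*} [Fintype Λ]
    (U : EuclideanSpace ℝ Λ ≃ₗᵢ[ℝ] SplitSpace (Fintype.card Λ)) (m ρ : ℝ)
    (F : EuclideanSpace ℝ Λ → ℝ) : ℝ :=
  let N : ℕ := Fintype.card Λ
  let σ : Measure (Metric.sphere (0 : EuclideanSpace ℝ (Fin (N - 1))) 1) :=
    (volume : Measure (EuclideanSpace ℝ (Fin (N - 1)))).toSphere
  1 / σ.real Set.univ *
    ∫ Ω, F (U.symm (WithLp.toLp 2
      (m * Real.sqrt N, Real.sqrt (N * (ρ - m ^ 2)) • (Ω : EuclideanSpace ℝ (Fin (N - 1)))))) ∂σ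

/-- The specific auxiliary microcanonical partition function `(ρ - m²)^((N - 3) / 2)`. -/
def microcanonicalZ (m ρ : ℝ) (N : ℕ) : ℝ :=
  (ρ - m ^ 2) ^ (((N : ℝ) - 3) / 2)

/-- Expectation `⟨F⟩_C^{μ, ρ; N}` in the auxiliary canonical ensemble: the mixture over the
magnetization density `m ∈ (-√ρ, √ρ)` of the auxiliary microcanonical ensembles, with weights
proportional to `exp (-μ N m) Z_MC (m, ρ; N)`. -/
def canonical {Λ : Type*} [Fintype Λ]
    (U : EuclideanSpace ℝ Λ ≃ₗᵢ[ℝ] SplitSpace (Fintype.card Λ)) (μ ρ : ℝ)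
    (F : EuclideanSpace ℝ Λ → ℝ) : ℝ :=
  let N : ℕ := Fintype.card Λ
  1 / (∫ m in (-Real.sqrt ρ)..(Real.sqrt ρ), Real.exp (-μ * N * m) * microcanonicalZ m ρ N) *
    ∫ m in (-Real.sqrt ρ)..(Real.sqrt ρ),
      Real.exp (-μ * N * m) * microcanonicalZ m ρ N * microcanonical U m ρ F

/-- The projection `P_I : ℝ^Λ → ℝ^n` onto the coordinates in `I`, for `I ⊂ Λ` enumerated by a
bijection `π : I → {0, …, n - 1}`. -/
def proj {Λ : Type*} {n : ℕ} (I : Finset Λ) (π : I ≃ Fin n)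
    (φ : EuclideanSpace ℝ Λ) : EuclideanSpace ℝ (Fin n) :=
  WithLp.toLp 2 fun j => φ (π.symm j : Λ)

end

end MeanFieldSpherical

/-!
A single uniform point `Ω` of the sphere couples the microcanonical ensembles at magnetizations `m`
and `x`. By rotation invariance, the mean square difference of the two fields at any site is exactly
the squared distance between the points `(m, √(ρ - m²))` and `(x, √(ρ - x²))` of the circle of
radius `√ρ`, which is at most a constant times `(x - m)²`. Hence the microcanonical expectation of a
Lipschitz function of `n` sites depends on the magnetization in a way controlled by `|x - m|`,
uniformly in `N`.

The canonical expectation averages microcanonical ones over a law of `x` on `[-√ρ, √ρ]`. The choice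
of `μ` puts the maximum of the leading exponent `N (-μ x + log (ρ - x²) / 2)` at `x = m`, and
integrating the derivative of `(x - m) (ρ - x²)` times the density turns this into a mean square
deviation from `m` of order `1 / N`.
-/

namespace MeanFieldSpherical

open Metric Set
open scoped NNReal Pointwise RealInnerProductSpace

theorem sq_integral_le_integral_sq {α : Type*} [MeasurableSpace α] {P : Measure α}
    [IsProbabilityMeasure P] {g : α → ℝ} (hg : Integrable g P)
    (hg_sq : Integrable (fun x => g x ^ 2) P) : (∫ x, g x ∂P) ^ 2 ≤ ∫ x, g x ^ 2 ∂P :=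
  even_two.convexOn_pow.map_integral_le (by fun_prop) isClosed_univ (by simp) hg hg_sq

section Sphere

variable {E : Type*} [NormedAddCommGroup E] [InnerProductSpace ℝ E]

/-- The action of a linear isometry on the unit sphere. -/
def sphereHomeomorph (e : E ≃ₗᵢ[ℝ] E) : sphere (0 : E) 1 ≃ₜ sphere (0 : E) 1 :=
  e.toHomeomorph.subtype fun x => by simp

@[simp]
theorem coe_sphereHomeomorph (e : E ≃ₗᵢ[ℝ] E) (x : sphere (0 : E) 1) :
    (sphereHomeomorph e x : E) = e x := rfl

variable [FiniteDimensional ℝ E] [MeasurableSpace E] [BorelSpace E]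

variable (E) in
/-- The rotation-invariant probability measure on the unit sphere of `E`. -/
noncomputable def uniformOnSphere : Measure (sphere (0 : E) 1) :=
  ((volume : Measure E).toSphere univ)⁻¹ • (volume : Measure E).toSphere

instance [Nontrivial E] : IsProbabilityMeasure (uniformOnSphere E) := by
  have : NeZero (volume : Measure E).toSphere := ⟨Measure.toSphere_ne_zero _⟩
  unfold uniformOnSphere
  infer_instance

theorem measurePreserving_sphereHomeomorph (e : E ≃ₗᵢ[ℝ] E) :
    MeasurePreserving (sphereHomeomorph e) (uniformOnSphere E) (uniformOnSphere E) := by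
  have hmeas := (sphereHomeomorph e).measurable
  refine MeasurePreserving.smul_measure ⟨hmeas, Measure.ext fun s hs => ?_⟩ _
  have sector_preimage :
      Ioo (0 : ℝ) 1 • ((↑) '' (sphereHomeomorph e ⁻¹' s) : Set E) =
        e ⁻¹' (Ioo (0 : ℝ) 1 • ((↑) '' s)) := by
    ext x
    simp only [mem_smul, mem_image, mem_preimage]
    constructor
    · rintro ⟨r, hr, _, ⟨y, hy, rfl⟩, rfl⟩
      exact ⟨r, hr, _, ⟨_, hy, rfl⟩, by simp⟩
    · rintro ⟨r, hr, _, ⟨y, hy, rfl⟩, h⟩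
      exact ⟨r, hr, _, ⟨(sphereHomeomorph e).symm y, by simpa using hy, rfl⟩,
        e.injective (by simpa [← coe_sphereHomeomorph] using h)⟩
  rw [Measure.map_apply hmeas hs, Measure.toSphere_apply' _ hs,
    Measure.toSphere_apply' _ (hmeas hs), sector_preimage,
    e.measurePreserving.measure_preimage_emb e.toHomeomorph.measurableEmbedding]

theorem integral_comp_sphereHomeomorph (e : E ≃ₗᵢ[ℝ] E) (g : sphere (0 : E) 1 → ℝ) :
    ∫ Ω, g (sphereHomeomorph e Ω) ∂uniformOnSphere E = ∫ Ω, g Ω ∂uniformOnSphere E :=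
  (measurePreserving_sphereHomeomorph e).integral_comp (sphereHomeomorph e).measurableEmbedding g

theorem integral_inner_uniformOnSphere (v : E) :
    ∫ Ω : sphere (0 : E) 1, ⟪v, Ω⟫ ∂uniformOnSphere E = 0 := by
  have antipodal := integral_comp_sphereHomeomorph (.neg ℝ) fun Ω : sphere (0 : E) 1 => ⟪v, Ω⟫
  simp only [coe_sphereHomeomorph, LinearIsometryEquiv.coe_neg, inner_neg_right,
    integral_neg] at antipodal
  linarith

theorem integral_inner_sq_uniformOnSphere_eq_of_norm_eq {v w : E} (h : ‖v‖ = ‖w‖) :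
    ∫ Ω : sphere (0 : E) 1, ⟪v, Ω⟫ ^ 2 ∂uniformOnSphere E =
      ∫ Ω : sphere (0 : E) 1, ⟪w, Ω⟫ ^ 2 ∂uniformOnSphere E := by
  set e : E ≃ₗᵢ[ℝ] E := (ℝ ∙ (v - w))ᗮ.reflection
  have he : e v = w := Submodule.reflection_sub h
  rw [← he, ← integral_comp_sphereHomeomorph e fun Ω => ⟪e v, (Ω : E)⟫ ^ 2]
  simp only [coe_sphereHomeomorph, e.inner_map_map]

variable [Nontrivial E]

theorem integrable_uniformOnSphere {g : sphere (0 : E) 1 → ℝ} (hg : Continuous g) :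
    Integrable g (uniformOnSphere E) :=
  hg.integrable_of_hasCompactSupport (.of_compactSpace g)

theorem integral_inner_sq_uniformOnSphere (v : E) :
    ∫ Ω : sphere (0 : E) 1, ⟪v, Ω⟫ ^ 2 ∂uniformOnSphere E = ‖v‖ ^ 2 / Module.finrank ℝ E := by
  set b := stdOrthonormalBasis ℝ E
  have h_basis (i) : ‖v‖ ^ 2 * ∫ Ω : sphere (0 : E) 1, ⟪b i, Ω⟫ ^ 2 ∂uniformOnSphere E =
      ∫ Ω : sphere (0 : E) 1, ⟪v, Ω⟫ ^ 2 ∂uniformOnSphere E := by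
    rw [integral_inner_sq_uniformOnSphere_eq_of_norm_eq (v := v) (w := ‖v‖ • b i)
      (by simp [norm_smul]), ← integral_const_mul]
    simp only [real_inner_smul_left, mul_pow]
  have h_sum : ∑ i, ∫ Ω : sphere (0 : E) 1, ⟪b i, Ω⟫ ^ 2 ∂uniformOnSphere E = 1 := by
    rw [← integral_finsetSum _ fun i _ => integrable_uniformOnSphere (by fun_prop)]
    simp [b.sum_sq_inner_right]
  rw [eq_div_iff (by exact_mod_cast Module.finrank_pos.ne'), mul_comm]
  calc Module.finrank ℝ E * ∫ Ω : sphere (0 : E) 1, ⟪v, Ω⟫ ^ 2 ∂uniformOnSphere E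
      = ∑ i, ‖v‖ ^ 2 * ∫ Ω : sphere (0 : E) 1, ⟪b i, Ω⟫ ^ 2 ∂uniformOnSphere E := by
        simp [h_basis]
    _ = ‖v‖ ^ 2 := by rw [← Finset.mul_sum, h_sum, mul_one]

theorem integral_sq_add_mul_inner_uniformOnSphere (a b : ℝ) (v : E) :
    ∫ Ω : sphere (0 : E) 1, (a + b * ⟪v, Ω⟫) ^ 2 ∂uniformOnSphere E =
      a ^ 2 + b ^ 2 * (‖v‖ ^ 2 / Module.finrank ℝ E) := by
  have expand (Ω : sphere (0 : E) 1) : (a + b * ⟪v, Ω⟫) ^ 2 =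
      a ^ 2 + (2 * a * b * ⟪v, Ω⟫ + b ^ 2 * ⟪v, Ω⟫ ^ 2) := by ring
  simp only [expand]
  rw [integral_add (integrable_const _) (integrable_uniformOnSphere (by fun_prop)),
    integral_add (integrable_uniformOnSphere (by fun_prop))
      (integrable_uniformOnSphere (by fun_prop)),
    integral_const_mul, integral_const_mul, integral_inner_uniformOnSphere,
    integral_inner_sq_uniformOnSphere]
  simp

end Sphere

section Microcanonical

variable {Λ : Type*}

theorem continuous_proj {n : ℕ} (I : Finset Λ) (π : I ≃ Fin n) : Continuous (proj I π) := by
  unfold proj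
  fun_prop

variable [Fintype Λ] {U : EuclideanSpace ℝ Λ ≃ₗᵢ[ℝ] SplitSpace (Fintype.card Λ)}

/-- The field of magnetization density `m` and square norm `ρ N` in the direction `Ω`, over which
`microcanonical U m ρ` averages. -/
noncomputable def microcanonicalField
    (U : EuclideanSpace ℝ Λ ≃ₗᵢ[ℝ] SplitSpace (Fintype.card Λ)) (m ρ : ℝ)
    (Ω : sphere (0 : EuclideanSpace ℝ (Fin (Fintype.card Λ - 1))) 1) : EuclideanSpace ℝ Λ :=
  U.symm (WithLp.toLp 2
    (m * √(Fintype.card Λ : ℝ), √((Fintype.card Λ : ℝ) * (ρ - m ^ 2)) • Ω.1))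

theorem microcanonical_eq_integral (m ρ : ℝ) (F : EuclideanSpace ℝ Λ → ℝ) :
    microcanonical U m ρ F = ∫ Ω, F (microcanonicalField U m ρ Ω) ∂uniformOnSphere _ := by
  simp only [microcanonical, microcanonicalField, uniformOnSphere, integral_smul_measure,
    ENNReal.toReal_inv, measureReal_def, one_div, smul_eq_mul]

theorem continuous_microcanonicalField (ρ : ℝ) :
    Continuous fun p : ℝ × sphere (0 : EuclideanSpace ℝ (Fin (Fintype.card Λ - 1))) 1 =>
      microcanonicalField U p.1 ρ p.2 :=
  U.symm.continuous.comp ((WithLp.prod_continuous_toLp 2 _ _).comp (by fun_prop))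

theorem continuous_microcanonical {F : EuclideanSpace ℝ Λ → ℝ} (hF : Continuous F) (ρ : ℝ) :
    Continuous fun x => microcanonical U x ρ F := by
  have h_integral := continuous_parametric_integral_of_continuous
    (μ := (volume : Measure (EuclideanSpace ℝ (Fin (Fintype.card Λ - 1)))).toSphere)
    (f := fun x Ω => F (microcanonicalField U x ρ Ω))
    (hF.comp (continuous_microcanonicalField ρ)) isCompact_univ
  rw [Measure.restrict_univ] at h_integral
  exact continuous_const.mul h_integral

open Classical in
/-- The vector whose inner product with `ψ` is the contribution of the fluctuation coordinates
`ψ` of a field to its value at the site `i`. -/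
noncomputable def fluctuationVector
    (U : EuclideanSpace ℝ Λ ≃ₗᵢ[ℝ] SplitSpace (Fintype.card Λ)) (i : Λ) :
    EuclideanSpace ℝ (Fin (Fintype.card Λ - 1)) :=
  (U (EuclideanSpace.single i 1)).snd

theorem IsMagnetizationFrame.norm_fluctuationVector_sq (hU : IsMagnetizationFrame U) (i : Λ) :
    ‖fluctuationVector U i‖ ^ 2 = 1 - 1 / Fintype.card Λ := by
  classical
  have h_norm := WithLp.prod_norm_sq_eq_of_L2 (U (EuclideanSpace.single i 1))
  rw [hU] at h_norm
  simp only [U.norm_map, PiLp.norm_single, norm_one, one_pow, PiLp.single_apply,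
    Finset.sum_ite_eq', Finset.mem_univ, ↓reduceIte, mul_one, Real.norm_eq_abs, sq_abs, div_pow,
    Real.sq_sqrt (Nat.cast_nonneg _)] at h_norm
  unfold fluctuationVector
  rw [eq_sub_iff_add_eq']
  convert h_norm.symm

theorem IsMagnetizationFrame.symm_apply (hU : IsMagnetizationFrame U) (a : ℝ)
    (ψ : EuclideanSpace ℝ (Fin (Fintype.card Λ - 1))) (i : Λ) :
    U.symm (WithLp.toLp 2 (a, ψ)) i = a / √(Fintype.card Λ : ℝ) + ⟪fluctuationVector U i, ψ⟫ := by
  classical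
  calc U.symm (WithLp.toLp 2 (a, ψ)) i
      = ⟪EuclideanSpace.single i (1 : ℝ), U.symm (WithLp.toLp 2 (a, ψ))⟫ := by
        simp [EuclideanSpace.inner_single_left]
    _ = ⟪(U (EuclideanSpace.single i 1)).fst, a⟫ + ⟪fluctuationVector U i, ψ⟫ := by
        rw [← U.inner_map_map, U.apply_symm_apply, WithLp.prod_inner_apply]
        unfold fluctuationVector
        congr!
    _ = _ := by
        rw [hU]
        simp [div_eq_mul_inv]

theorem IsMagnetizationFrame.microcanonicalField_apply (hU : IsMagnetizationFrame U) (m ρ : ℝ)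
    (Ω : sphere (0 : EuclideanSpace ℝ (Fin (Fintype.card Λ - 1))) 1) (i : Λ) :
    microcanonicalField U m ρ Ω i =
      m + √(Fintype.card Λ : ℝ) * √(ρ - m ^ 2) * ⟪fluctuationVector U i, Ω⟫ := by
  have : Nonempty Λ := ⟨i⟩
  have h_sqrt : √(Fintype.card Λ : ℝ) ≠ 0 := by positivity
  rw [microcanonicalField, hU.symm_apply, mul_div_cancel_right₀ _ h_sqrt,
    Real.sqrt_mul (Nat.cast_nonneg _), real_inner_smul_right]

theorem IsMagnetizationFrame.integral_sq_microcanonicalField_sub (hU : IsMagnetizationFrame U)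
    (hN : 2 ≤ Fintype.card Λ) (m x ρ : ℝ) (i : Λ) :
    ∫ Ω, (microcanonicalField U m ρ Ω i - microcanonicalField U x ρ Ω i) ^ 2 ∂uniformOnSphere _ =
      (m - x) ^ 2 + (√(ρ - m ^ 2) - √(ρ - x ^ 2)) ^ 2 := by
  have : Nonempty (Fin (Fintype.card Λ - 1)) := ⟨⟨0, by lia⟩⟩
  have hN' : (2 : ℝ) ≤ Fintype.card Λ := by exact_mod_cast hN
  have affine (Ω) : microcanonicalField U m ρ Ω i - microcanonicalField U x ρ Ω i =
      (m - x) + √(Fintype.card Λ : ℝ) * (√(ρ - m ^ 2) - √(ρ - x ^ 2)) *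
        ⟪fluctuationVector U i, Ω⟫ := by
    rw [hU.microcanonicalField_apply, hU.microcanonicalField_apply]
    ring
  simp only [affine]
  rw [integral_sq_add_mul_inner_uniformOnSphere, hU.norm_fluctuationVector_sq,
    finrank_euclideanSpace_fin, Nat.cast_pred (by lia), mul_pow, Real.sq_sqrt (by linarith)]
  field_simp [show (Fintype.card Λ : ℝ) - 1 ≠ 0 by linarith]

theorem IsMagnetizationFrame.integral_norm_sq_proj_sub (hU : IsMagnetizationFrame U)
    (hN : 2 ≤ Fintype.card Λ) (m x ρ : ℝ) {n : ℕ} (I : Finset Λ) (π : I ≃ Fin n) :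
    ∫ Ω, ‖proj I π (microcanonicalField U m ρ Ω) - proj I π (microcanonicalField U x ρ Ω)‖ ^ 2
        ∂uniformOnSphere _ =
      n * ((m - x) ^ 2 + (√(ρ - m ^ 2) - √(ρ - x ^ 2)) ^ 2) := by
  have : Nonempty (Fin (Fintype.card Λ - 1)) := ⟨⟨0, by lia⟩⟩
  have h_field (y : ℝ) : Continuous (microcanonicalField U y ρ) :=
    (continuous_microcanonicalField ρ).comp (.prodMk_right y)
  simp only [EuclideanSpace.real_norm_sq_eq, PiLp.sub_apply, proj]
  rw [integral_finsetSum _ fun j _ => integrable_uniformOnSphere (by fun_prop)]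
  simp only [hU.integral_sq_microcanonicalField_sub hN, Finset.sum_const, Finset.card_univ,
    Fintype.card_fin, nsmul_eq_mul]

theorem IsMagnetizationFrame.sq_microcanonical_sub_le (hU : IsMagnetizationFrame U)
    (hN : 2 ≤ Fintype.card Λ) (m x ρ : ℝ) {n : ℕ} {f : EuclideanSpace ℝ (Fin n) → ℝ} {L : ℝ≥0}
    (hf : LipschitzWith L f) (I : Finset Λ) (π : I ≃ Fin n) :
    (microcanonical U m ρ (f ∘ proj I π) - microcanonical U x ρ (f ∘ proj I π)) ^ 2 ≤
      L ^ 2 * (n * ((m - x) ^ 2 + (√(ρ - m ^ 2) - √(ρ - x ^ 2)) ^ 2)) := by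
  have : Nonempty (Fin (Fintype.card Λ - 1)) := ⟨⟨0, by lia⟩⟩
  have h_local (y : ℝ) : Continuous fun Ω => proj I π (microcanonicalField U y ρ Ω) :=
    (continuous_proj I π).comp ((continuous_microcanonicalField ρ).comp (.prodMk_right y))
  have h_obs (y : ℝ) : Continuous fun Ω => f (proj I π (microcanonicalField U y ρ Ω)) :=
    hf.continuous.comp (h_local y)
  have h_diff : Continuous fun Ω => f (proj I π (microcanonicalField U m ρ Ω)) -
      f (proj I π (microcanonicalField U x ρ Ω)) := (h_obs m).sub (h_obs x)
  simp only [microcanonical_eq_integral, Function.comp_apply]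
  rw [← integral_sub (integrable_uniformOnSphere (h_obs m)) (integrable_uniformOnSphere (h_obs x)),
    ← hU.integral_norm_sq_proj_sub hN m x ρ I π, ← integral_const_mul]
  refine (sq_integral_le_integral_sq (integrable_uniformOnSphere h_diff)
    (integrable_uniformOnSphere (h_diff.pow 2))).trans ?_
  refine integral_mono (integrable_uniformOnSphere (h_diff.pow 2))
    (integrable_uniformOnSphere (by fun_prop)) fun Ω => ?_
  simpa only [← mul_pow, Real.norm_eq_abs, sq_abs] using
    pow_le_pow_left₀ (norm_nonneg _) (hf.norm_sub_le _ _) 2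

end Microcanonical

section Magnetization

variable {ρ m μ x : ℝ} {N : ℕ}

theorem sub_sq_pos_of_mem_Ioo (hx : x ∈ Ioo (-√ρ) √ρ) : 0 < ρ - x ^ 2 :=
  sub_pos.2 (Real.sq_lt.2 hx)

theorem sub_sq_nonneg_of_mem_Icc (hρ : 0 ≤ ρ) (hx : x ∈ Icc (-√ρ) √ρ) : 0 ≤ ρ - x ^ 2 :=
  sub_nonneg.2 ((Real.sq_le hρ).2 hx)

theorem sqrt_mul_sqrt_sub_abs_le (hρ : 0 ≤ ρ) (hx : x ∈ Icc (-√ρ) √ρ) :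
    √ρ * (√ρ - |m|) ≤ ρ - |x * m| := by
  rw [mul_sub, Real.mul_self_sqrt hρ, abs_mul]
  gcongr
  exact abs_le.2 hx

/-- `(x, √(ρ - x²))` and `(m, √(ρ - m²))` lie on the circle of radius `√ρ`. -/
theorem sq_sub_add_sq_sqrt_sub_sqrt_le (hm : m ∈ Ioo (-√ρ) √ρ) (hx : x ∈ Icc (-√ρ) √ρ) :
    (m - x) ^ 2 + (√(ρ - m ^ 2) - √(ρ - x ^ 2)) ^ 2 ≤ 2 * √ρ / (√ρ - |m|) * (x - m) ^ 2 := by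
  set a := √(ρ - m ^ 2)
  set b := √(ρ - x ^ 2)
  have hsm : |m| < √ρ := abs_lt.2 hm
  have hs : 0 < √ρ := (abs_nonneg m).trans_lt hsm
  have hρ : √ρ ^ 2 = ρ := Real.sq_sqrt (Real.sqrt_pos.1 hs).le
  have ha : a ^ 2 = ρ - m ^ 2 := Real.sq_sqrt (sub_sq_pos_of_mem_Ioo hm).le
  have hb : b ^ 2 = ρ - x ^ 2 := Real.sq_sqrt (sub_sq_nonneg_of_mem_Icc (Real.sqrt_pos.1 hs).le hx)
  have h_gap : √ρ * (√ρ - |m|) ≤ ρ - x * m + a * b := by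
    have : 0 ≤ a * b := by positivity
    linarith [le_abs_self (x * m), sqrt_mul_sqrt_sub_abs_le (m := m) (Real.sqrt_pos.1 hs).le hx]
  rw [div_mul_eq_mul_div, le_div_iff₀ (sub_pos.2 hsm)]
  refine le_of_mul_le_mul_left ?_ hs
  calc √ρ * (((m - x) ^ 2 + (a - b) ^ 2) * (√ρ - |m|))
      = ((m - x) ^ 2 + (a - b) ^ 2) * (√ρ * (√ρ - |m|)) := by ring
    _ ≤ ((m - x) ^ 2 + (a - b) ^ 2) * (ρ - x * m + a * b) := by gcongr
    _ = 2 * (ρ - x * m - a * b) * (ρ - x * m + a * b) := by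
      linear_combination (ρ - x * m + a * b) * (ha + hb)
    _ = √ρ * (2 * √ρ * (x - m) ^ 2) := by
      linear_combination (-2 * b ^ 2) * ha - 2 * (ρ - m ^ 2) * hb - 2 * (x - m) ^ 2 * hρ

/-- The unnormalized density of the magnetization in the canonical ensemble. -/
noncomputable def magnetizationWeight (μ ρ : ℝ) (N : ℕ) (x : ℝ) : ℝ :=
  Real.exp (-μ * N * x) * microcanonicalZ x ρ N

theorem continuous_magnetizationWeight (μ ρ : ℝ) (hN : 3 ≤ N) :
    Continuous (magnetizationWeight μ ρ N) := by
  have hN' : (3 : ℝ) ≤ N := by exact_mod_cast hN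
  unfold magnetizationWeight microcanonicalZ
  exact (by fun_prop : Continuous fun x : ℝ => Real.exp (-μ * N * x)).mul
    (Continuous.rpow_const (by fun_prop) fun x => Or.inr (by linarith))

theorem magnetizationWeight_pos (μ : ℝ) (N : ℕ) (hx : x ∈ Ioo (-√ρ) √ρ) :
    0 < magnetizationWeight μ ρ N x :=
  mul_pos (Real.exp_pos _) (Real.rpow_pos_of_pos (sub_sq_pos_of_mem_Ioo hx) _)

theorem magnetizationWeight_nonneg (μ : ℝ) (N : ℕ) (hρ : 0 ≤ ρ) (hx : x ∈ Icc (-√ρ) √ρ) :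
    0 ≤ magnetizationWeight μ ρ N x :=
  mul_nonneg (Real.exp_nonneg _) (Real.rpow_nonneg (sub_sq_nonneg_of_mem_Icc hρ hx) _)

theorem integral_magnetizationWeight_pos (μ : ℝ) (hρ : 0 < ρ) (hN : 3 ≤ N) :
    0 < ∫ x in (-√ρ)..√ρ, magnetizationWeight μ ρ N x :=
  intervalIntegral.intervalIntegral_pos_of_pos_on
    ((continuous_magnetizationWeight μ ρ hN).intervalIntegrable _ _)
    (fun _ hx => magnetizationWeight_pos μ N hx) (neg_lt_self (Real.sqrt_pos.2 hρ))

theorem hasDerivAt_magnetizationWeight (μ : ℝ) (N : ℕ) (hx : ρ - x ^ 2 ≠ 0) :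
    HasDerivAt (magnetizationWeight μ ρ N)
      (magnetizationWeight μ ρ N x * (-μ * N - (N - 3) * x / (ρ - x ^ 2))) x := by
  have h_exp : HasDerivAt (fun y => Real.exp (-μ * N * y))
      (Real.exp (-μ * N * x) * (-μ * N)) x := by
    simpa using ((hasDerivAt_id x).const_mul (-μ * N)).exp
  have h_base : HasDerivAt (fun y => ρ - y ^ 2) (-(2 * x)) x := by
    simpa using (hasDerivAt_pow 2 x).const_sub ρ
  have h_pow := h_base.rpow_const (p := ((N : ℝ) - 3) / 2) (Or.inl hx)
  refine (h_exp.mul h_pow).congr_deriv ?_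
  rw [Real.rpow_sub_one hx, magnetizationWeight, microcanonicalZ]
  field_simp
  ring

/-- The law of the magnetization density in the canonical ensemble. -/
noncomputable def magnetizationLaw (μ ρ : ℝ) (N : ℕ) : Measure ℝ :=
  (volume.restrict (Ioc (-√ρ) √ρ)).withDensity fun x => ENNReal.ofReal
    (magnetizationWeight μ ρ N x / ∫ y in (-√ρ)..√ρ, magnetizationWeight μ ρ N y)

theorem ae_mem_Icc_magnetizationLaw (μ ρ : ℝ) (N : ℕ) :
    ∀ᵐ x ∂magnetizationLaw μ ρ N, x ∈ Icc (-√ρ) √ρ :=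
  (withDensity_absolutelyContinuous _ _).ae_le <|
    (ae_restrict_mem measurableSet_Ioc).mono fun _ hx => Ioc_subset_Icc_self hx

theorem density_magnetizationLaw_nonneg (μ : ℝ) (hρ : 0 < ρ) (hN : 3 ≤ N) :
    ∀ᵐ x ∂volume.restrict (Ioc (-√ρ) √ρ),
      0 ≤ magnetizationWeight μ ρ N x / ∫ y in (-√ρ)..√ρ, magnetizationWeight μ ρ N y := by
  filter_upwards [ae_restrict_mem measurableSet_Ioc] with x hx
  exact div_nonneg (magnetizationWeight_nonneg μ N hρ.le (Ioc_subset_Icc_self hx))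
    (integral_magnetizationWeight_pos μ hρ hN).le

theorem isProbabilityMeasure_magnetizationLaw (μ : ℝ) (hρ : 0 < ρ) (hN : 3 ≤ N) :
    IsProbabilityMeasure (magnetizationLaw μ ρ N) := by
  have h_cont : Continuous fun x =>
      magnetizationWeight μ ρ N x / ∫ y in (-√ρ)..√ρ, magnetizationWeight μ ρ N y :=
    (continuous_magnetizationWeight μ ρ hN).div_const _
  have h_le : -√ρ ≤ √ρ := neg_le_self (Real.sqrt_nonneg ρ)
  refine ⟨?_⟩
  rw [magnetizationLaw, withDensity_apply _ .univ, Measure.restrict_univ,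
    ← ofReal_integral_eq_lintegral_ofReal
      ((intervalIntegrable_iff_integrableOn_Ioc_of_le h_le).1 (h_cont.intervalIntegrable _ _))
      (density_magnetizationLaw_nonneg μ hρ hN),
    ← intervalIntegral.integral_of_le h_le, intervalIntegral.integral_div,
    div_self (integral_magnetizationWeight_pos μ hρ hN).ne', ENNReal.ofReal_one]

theorem integral_magnetizationLaw (μ : ℝ) (hρ : 0 < ρ) (hN : 3 ≤ N) (g : ℝ → ℝ) :
    ∫ x, g x ∂magnetizationLaw μ ρ N =
      1 / (∫ x in (-√ρ)..√ρ, magnetizationWeight μ ρ N x) *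
        ∫ x in (-√ρ)..√ρ, magnetizationWeight μ ρ N x * g x := by
  have h_meas : Measurable fun x => ENNReal.ofReal
      (magnetizationWeight μ ρ N x / ∫ y in (-√ρ)..√ρ, magnetizationWeight μ ρ N y) :=
    ((continuous_magnetizationWeight μ ρ hN).div_const _).measurable.ennreal_ofReal
  rw [← intervalIntegral.integral_const_mul,
    intervalIntegral.integral_of_le (neg_le_self (Real.sqrt_nonneg ρ)), magnetizationLaw,
    integral_withDensity_eq_integral_toReal_smul h_meas (by simp)]
  refine integral_congr_ae ?_
  filter_upwards [density_magnetizationLaw_nonneg μ hρ hN] with x hx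
  rw [ENNReal.toReal_ofReal hx, smul_eq_mul]
  ring

theorem integrable_magnetizationLaw (μ : ℝ) (hρ : 0 < ρ) (hN : 3 ≤ N) {g : ℝ → ℝ}
    (hg : Continuous g) : Integrable g (magnetizationLaw μ ρ N) := by
  have := isProbabilityMeasure_magnetizationLaw μ hρ hN
  obtain ⟨B, hB⟩ := (isCompact_Icc (a := -√ρ) (b := √ρ)).exists_bound_of_continuousOn
    hg.continuousOn
  exact Integrable.of_bound hg.aestronglyMeasurable B
    ((ae_mem_Icc_magnetizationLaw μ ρ N).mono hB)

/-- Integrate the derivative of `(x - m) * (ρ - x ^ 2) * magnetizationWeight μ ρ N x`, which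
vanishes at both endpoints. -/
theorem integral_magnetizationLaw_eq_zero (hm : m ∈ Ioo (-√ρ) √ρ) (hμ : μ = -(m / (ρ - m ^ 2)))
    (hN : 3 ≤ N) :
    ∫ x, (ρ - x * m - N / (ρ - m ^ 2) * ((x - m) ^ 2 * (ρ + x * m))) ∂magnetizationLaw μ ρ N =
      0 := by
  have hρ : 0 < ρ := Real.sqrt_pos.1 ((abs_nonneg m).trans_lt (abs_lt.2 hm))
  have hm_sq := sub_sq_pos_of_mem_Ioo hm
  have hw := continuous_magnetizationWeight μ ρ hN
  have h_deriv : ∀ x ∈ Ioo (-√ρ) √ρ,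
      HasDerivAt (fun y => (y - m) * (ρ - y ^ 2) * magnetizationWeight μ ρ N y)
        (magnetizationWeight μ ρ N x *
          (ρ - x * m - N / (ρ - m ^ 2) * ((x - m) ^ 2 * (ρ + x * m)))) x := by
    intro x hx
    have hx_sq := sub_sq_pos_of_mem_Ioo hx
    refine ((((hasDerivAt_id x).sub_const m).mul ((hasDerivAt_pow 2 x).const_sub ρ)).mul
      (hasDerivAt_magnetizationWeight μ N hx_sq.ne')).congr_deriv ?_
    simp only [id_eq, Pi.mul_apply, hμ]
    field_simp
    ring
  rw [integral_magnetizationLaw μ hρ hN, intervalIntegral.integral_eq_sub_of_hasDerivAt_of_le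
    (neg_le_self (Real.sqrt_nonneg ρ)) (by fun_prop) h_deriv
    (Continuous.intervalIntegrable (by fun_prop) _ _)]
  simp [Real.sq_sqrt hρ.le]

theorem integral_sq_sub_magnetizationLaw_le (hm : m ∈ Ioo (-√ρ) √ρ)
    (hμ : μ = -(m / (ρ - m ^ 2))) (hN : 3 ≤ N) :
    ∫ x, (x - m) ^ 2 ∂magnetizationLaw μ ρ N ≤ 2 * √ρ / (√ρ - |m|) * ((ρ - m ^ 2) / N) := by
  have hsm : |m| < √ρ := abs_lt.2 hm
  have hs : 0 < √ρ := (abs_nonneg m).trans_lt hsm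
  have hρ : 0 < ρ := Real.sqrt_pos.1 hs
  have hm_sq := sub_sq_pos_of_mem_Ioo hm
  have : (0 : ℝ) < N := by exact_mod_cast (by lia : 0 < N)
  have := isProbabilityMeasure_magnetizationLaw μ hρ hN
  set c := N / (ρ - m ^ 2) * (√ρ * (√ρ - |m|)) with hc
  have hc_pos : 0 < c := by have := sub_pos.2 hsm; positivity
  have pointwise : ∀ᵐ x ∂magnetizationLaw μ ρ N, c * (x - m) ^ 2 ≤
      2 * ρ - (ρ - x * m - N / (ρ - m ^ 2) * ((x - m) ^ 2 * (ρ + x * m))) := by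
    filter_upwards [ae_mem_Icc_magnetizationLaw μ ρ N] with x hx
    have h_gap : √ρ * (√ρ - |m|) ≤ ρ + x * m := by
      linarith [neg_abs_le (x * m), sqrt_mul_sqrt_sub_abs_le (m := m) hρ.le hx]
    have : 0 ≤ √ρ * (√ρ - |m|) := mul_nonneg hs.le (sub_pos.2 hsm).le
    calc c * (x - m) ^ 2
        = N / (ρ - m ^ 2) * ((x - m) ^ 2 * (√ρ * (√ρ - |m|))) := by rw [hc]; ring
      _ ≤ N / (ρ - m ^ 2) * ((x - m) ^ 2 * (ρ + x * m)) := by gcongr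
      _ ≤ _ := by linarith
  have integrated : c * ∫ x, (x - m) ^ 2 ∂magnetizationLaw μ ρ N ≤ 2 * ρ := by
    have := integral_mono_ae (integrable_magnetizationLaw μ hρ hN (by fun_prop))
      (integrable_magnetizationLaw μ hρ hN (by fun_prop)) pointwise
    rw [integral_const_mul, integral_sub (integrable_const _)
      (integrable_magnetizationLaw μ hρ hN (by fun_prop)),
      integral_magnetizationLaw_eq_zero hm hμ hN] at this
    simpa using this
  calc ∫ x, (x - m) ^ 2 ∂magnetizationLaw μ ρ N ≤ 2 * ρ / c := by
        rwa [le_div_iff₀' hc_pos]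
    _ = 2 * √ρ / (√ρ - |m|) * ((ρ - m ^ 2) / N) := by
        have := (sub_pos.2 hsm).ne'
        rw [hc]
        nth_rw 1 [← Real.mul_self_sqrt hρ.le]
        field_simp

end Magnetization

section Canonical

variable {Λ : Type*} [Fintype Λ] {U : EuclideanSpace ℝ Λ ≃ₗᵢ[ℝ] SplitSpace (Fintype.card Λ)}

theorem canonical_eq_integral (μ : ℝ) {ρ : ℝ} (hρ : 0 < ρ) (hN : 3 ≤ Fintype.card Λ)
    (F : EuclideanSpace ℝ Λ → ℝ) :
    canonical U μ ρ F = ∫ x, microcanonical U x ρ F ∂magnetizationLaw μ ρ (Fintype.card Λ) :=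
  (integral_magnetizationLaw μ hρ hN _).symm

theorem sq_microcanonical_sub_canonical_le {F : EuclideanSpace ℝ Λ → ℝ} (hF : Continuous F)
    (hN : 3 ≤ Fintype.card Λ) {ρ m μ K : ℝ} (hρ : 0 < ρ)
    (hK : ∀ x ∈ Icc (-√ρ) √ρ,
      (microcanonical U m ρ F - microcanonical U x ρ F) ^ 2 ≤ K * (x - m) ^ 2) :
    (microcanonical U m ρ F - canonical U μ ρ F) ^ 2 ≤
      K * ∫ x, (x - m) ^ 2 ∂magnetizationLaw μ ρ (Fintype.card Λ) := by
  have := isProbabilityMeasure_magnetizationLaw μ hρ hN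
  have h_integrable {g : ℝ → ℝ} (hg : Continuous g) := integrable_magnetizationLaw μ hρ hN hg
  have h_cont := continuous_microcanonical (U := U) hF ρ
  calc (microcanonical U m ρ F - canonical U μ ρ F) ^ 2
      = (∫ x, (microcanonical U m ρ F - microcanonical U x ρ F)
          ∂magnetizationLaw μ ρ (Fintype.card Λ)) ^ 2 := by
        rw [canonical_eq_integral μ hρ hN, integral_sub (integrable_const _) (h_integrable h_cont)]
        simp
    _ ≤ ∫ x, (microcanonical U m ρ F - microcanonical U x ρ F) ^ 2
          ∂magnetizationLaw μ ρ (Fintype.card Λ) :=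
        sq_integral_le_integral_sq (h_integrable (by fun_prop)) (h_integrable (by fun_prop))
    _ ≤ ∫ x, K * (x - m) ^ 2 ∂magnetizationLaw μ ρ (Fintype.card Λ) :=
        integral_mono_ae (h_integrable (by fun_prop)) (h_integrable (by fun_prop))
          ((ae_mem_Icc_magnetizationLaw μ ρ _).mono hK)
    _ = K * ∫ x, (x - m) ^ 2 ∂magnetizationLaw μ ρ (Fintype.card Λ) := integral_const_mul _ _

end Canonical

end MeanFieldSpherical

open MeanFieldSpherical in
theorem mainTheorem10_general {ρ m μ : ℝ} (hm : m ∈ Set.Ioo (-√ρ) √ρ)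
    (hμ : μ = -(m / (ρ - m ^ 2))) {n : ℕ} {f : EuclideanSpace ℝ (Fin n) → ℝ} {L : NNReal}
    (hf : LipschitzWith L f) {Λ : Type*} [Fintype Λ] (hN : 3 ≤ Fintype.card Λ)
    {U : EuclideanSpace ℝ Λ ≃ₗᵢ[ℝ] SplitSpace (Fintype.card Λ)} (hU : IsMagnetizationFrame U)
    (I : Finset Λ) (π : I ≃ Fin n) :
    |microcanonical U m ρ (f ∘ proj I π) - canonical U μ ρ (f ∘ proj I π)| ≤
      L * √n * (2 * √ρ / (√ρ - |m|)) * √(ρ - m ^ 2) *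
        (Fintype.card Λ : ℝ) ^ (-(1 / 2) : ℝ) := by
  have hsm : 0 < √ρ - |m| := sub_pos.2 (abs_lt.2 hm)
  have hρ : 0 < ρ := Real.sqrt_pos.1 ((abs_nonneg m).trans_lt (abs_lt.2 hm))
  have hm_sq := (sub_sq_pos_of_mem_Ioo hm).le
  set K := 2 * √ρ / (√ρ - |m|)
  have h_lipschitz : ∀ x ∈ Set.Icc (-√ρ) √ρ,
      (microcanonical U m ρ (f ∘ proj I π) - microcanonical U x ρ (f ∘ proj I π)) ^ 2 ≤
        L ^ 2 * n * K * (x - m) ^ 2 := fun x hx => by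
    refine (hU.sq_microcanonical_sub_le (by lia) m x ρ hf I π).trans ?_
    rw [← mul_assoc, mul_assoc _ K]
    gcongr
    exact sq_sub_add_sq_sqrt_sub_sqrt_le hm hx
  refine abs_le_of_sq_le_sq ?_ (by positivity)
  calc (microcanonical U m ρ (f ∘ proj I π) - canonical U μ ρ (f ∘ proj I π)) ^ 2
      ≤ L ^ 2 * n * K * ∫ x, (x - m) ^ 2 ∂magnetizationLaw μ ρ (Fintype.card Λ) :=
        sq_microcanonical_sub_canonical_le (hf.continuous.comp (continuous_proj I π)) hN hρ
          h_lipschitz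
    _ ≤ L ^ 2 * n * K * (K * ((ρ - m ^ 2) / Fintype.card Λ)) := by
        gcongr
        exact integral_sq_sub_magnetizationLaw_le hm hμ hN
    _ = (L * √n * K * √(ρ - m ^ 2) * (Fintype.card Λ : ℝ) ^ (-(1 / 2) : ℝ)) ^ 2 := by
        rw [Real.rpow_neg (Nat.cast_nonneg _), ← Real.sqrt_eq_rpow, mul_pow, mul_pow, mul_pow,
          mul_pow, inv_pow, Real.sq_sqrt hm_sq, Real.sq_sqrt (Nat.cast_nonneg n),
          Real.sq_sqrt (Nat.cast_nonneg _)]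
        ring

theorem mainTheorem10 (ρ m μ : ℝ) (hρ : 0 < ρ) (hm : m ∈ Set.Ioo (-Real.sqrt ρ) (Real.sqrt ρ))
    (hμ : μ = -(m / (ρ - m ^ 2))) (n : ℕ) (f : EuclideanSpace ℝ (Fin n) → ℝ)
    (hf_bdd : ∃ B : ℝ, ∀ x, |f x| ≤ B) (hf_lip : LipschitzWith 1 f) :
    ∃ (C : ℝ) (N₀ : ℕ), ∀ (Λ : Type*) [Fintype Λ], N₀ ≤ Fintype.card Λ →
      ∀ (U : EuclideanSpace ℝ Λ ≃ₗᵢ[ℝ] MeanFieldSpherical.SplitSpace (Fintype.card Λ)),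
        MeanFieldSpherical.IsMagnetizationFrame U →
      ∀ (I : Finset Λ) (π : I ≃ Fin n),
        |MeanFieldSpherical.microcanonical U m ρ (f ∘ MeanFieldSpherical.proj I π) -
          MeanFieldSpherical.canonical U μ ρ (f ∘ MeanFieldSpherical.proj I π)| ≤
          C * (Fintype.card Λ : ℝ) ^ (-(1 / 2) : ℝ) :=
  ⟨_, 3, fun _ _ hN _ hU I π => mainTheorem10_general hm hμ hf_lip hN hU I π⟩
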